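/- \textbf{Theorem (Ergodic Theorem).} Let $\Omega$ be a finite set, let $P$ be a stochastic matrix indexed by $\Omega$ (nonnegative entries, all row sums equal to $1$), and let $X=(X_0,X_1,X_2,\ldots)$ be a Markov chain on $\Omega$ with transition matrix $P$ and arbitrary initial distribution; that is, the $X_n$ are $\Omega$-valued random variables on a common probability space such that \[ \mathbb P(X_{n+1}=y\mid X_0=x_0,\ldots,X_{n-1}=x_{n-1},X_n=x)=\mathbb P(X_{n+1}=y\mid X_n=x)=P_{xy} \] for all $n\ge 0$ and all $x_0,\ldots,x_{n-1},x,y\in\Omega$ for which the conditioning event $\{X_0=x_0,\ldots,X_{n-1}=x_{n-1},X_n=x\}$ has positive probability. Suppose that the chain is irreducible: for all $x,y\in\Omega$ there is an integer $k\ge 1$ with $(P^k)_{xy}>0$. Then $P$ has a unique stationary distribution $\pi$ (a probability vector on $\Omega$ with $\pi P=\pi$), and for every function $f:\Omega\to\mathbb R$, with probability $1$, \[ \lim_{n\to\infty}\frac1n\sum_{j=0}^{n-1}f(X_j)=\mathbb E_\pi(f):=\sum_{x\in\Omega}\pi(x)f(x). \] -/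

import Mathlib

open MeasureTheory ProbabilityTheory Filter Topology

/-- `X` is a (time-homogeneous) Markov chain on the finite state space `S` with transition matrix
`P`, on the probability space `(Ω, μ)`: `P` is a stochastic matrix, every `X n` is a random
variable, and for every history `j 0, …, j n` of positive probability and every state `y`,
`ℙ(X (n+1) = y | X 0 = j 0, …, X n = j n) = ℙ(X (n+1) = y | X n = j n) = P (j n) y`.
The law of `X 0` is arbitrary. -/
structure IsMarkovChain {Ω S : Type*} [MeasurableSpace Ω] [MeasurableSpace S] [Fintype S]
    [DecidableEq S] (μ : Measure Ω) (P : Matrix S S ℝ) (X : ℕ → Ω → S) : Prop where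
  stochastic : P ∈ Matrix.rowStochastic ℝ S
  measurable : ∀ n, Measurable (X n)
  markov : ∀ (n : ℕ) (j : ℕ → S) (y : S),
    μ {ω | ∀ k ≤ n, X k ω = j k} ≠ 0 →
      μ[{ω | X (n + 1) ω = y} | {ω | ∀ k ≤ n, X k ω = j k}]
          = μ[{ω | X (n + 1) ω = y} | {ω | X n ω = j n}] ∧
        μ[{ω | X (n + 1) ω = y} | {ω | X n ω = j n}] = ENNReal.ofReal (P (j n) y)

/-- `π` is a stationary distribution of `P`: a probability vector with `π P = π`. -/
def IsStationaryDistribution {S : Type*} [Fintype S] (P : Matrix S S ℝ) (π : S → ℝ) : Prop :=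
  π ∈ stdSimplex ℝ S ∧ Matrix.vecMul π P = π

/-!
The proof runs through Poisson's equation. By the maximum principle, irreducibility forces every
`g` with `P g = g` to be constant (`eq_of_mulVec_eq_self`). Since `1 - P` is singular, it also has a
left null vector; taking absolute values and normalising gives a stationary distribution `π`
(`exists_isStationaryDistribution`). The map `g ↦ g - P g + π(g) 1` is then injective, hence
surjective, so every `f` satisfies `f - π(f) = g - P g` for some `g` (`exists_poisson_solution`).
Integrating this identity against a second stationary distribution shows that `π` is unique.

Along the chain, Poisson's equation reads
`∑_{j<n} (f (X_j) - π(f)) = g (X_0) - g (X_n) + ∑_{j<n} (g (X_{j+1}) - (P g) (X_j))`.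
The boundary terms are bounded, and the summands of the last sum are bounded and orthogonal to
every function of the past (`IsMarkovChain.integral_history_mul_eq_zero`). Its second moment is
therefore `O(n)`, so along `n = k ^ 2` the averages are square summable in `L²` and tend to `0`
almost surely; bounded increments fill the gaps between consecutive squares
(`ae_tendsto_sum_div_of_orthogonal`).
-/

/-! ### Harmonic functions and stationary distributions -/

section Stationary

variable {S : Type*} [Fintype S] [DecidableEq S] {P : Matrix S S ℝ}

open Matrix

/-- **Maximum principle**: a harmonic function of an irreducible stochastic matrix is constant. -/
theorem eq_of_mulVec_eq_self (hS : P ∈ rowStochastic ℝ S) (hP : P.IsIrreducible)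
    {g : S → ℝ} (hg : P *ᵥ g = g) (x y : S) : g x = g y := by
  have : Nonempty S := ⟨x⟩
  obtain ⟨m, hm⟩ := Finite.exists_max g
  suffices h : ∀ z, g z = g m by rw [h x, h y]
  intro z
  obtain ⟨k, -, hk⟩ := (isIrreducible_iff_exists_pow_pos hS.1).1 hP m z
  have hQ : P ^ k ∈ rowStochastic ℝ S := pow_mem hS k
  have hgk : P ^ k *ᵥ g = g := by
    clear hk hQ
    induction k with
    | zero => simp
    | succ k ih => rw [pow_succ, ← mulVec_mulVec, hg, ih]
  have hsum : ∑ w, (P ^ k) m w * (g m - g w) = 0 := by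
    have h1 : ∑ w, (P ^ k) m w * g w = g m := congrFun hgk m
    simp only [mul_sub, Finset.sum_sub_distrib, ← Finset.sum_mul, h1,
      sum_row_of_mem_rowStochastic hQ, one_mul, sub_self]
  have hz := (Finset.sum_eq_zero_iff_of_nonneg
    (fun w _ => mul_nonneg (hQ.1 m w) (sub_nonneg.2 (hm w)))).1 hsum z (Finset.mem_univ z)
  rcases mul_eq_zero.1 hz with h | h
  · exact absurd h hk.ne'
  · linarith

theorem exists_isStationaryDistribution [Nonempty S] (hS : P ∈ rowStochastic ℝ S) :
    ∃ π : S → ℝ, IsStationaryDistribution P π := by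
  have hdet : (1 - P).det = 0 :=
    exists_mulVec_eq_zero_iff.1 ⟨1, one_ne_zero, by rw [sub_mulVec, one_mulVec, hS.2, sub_self]⟩
  obtain ⟨v, hv0, hv⟩ := exists_vecMul_eq_zero_iff.2 hdet
  rw [vecMul_sub, vecMul_one, sub_eq_zero] at hv
  have hle : ∀ y ∈ Finset.univ, |v y| ≤ ∑ x, |v x| * P x y := fun y _ => by
    calc |v y| = |∑ x, v x * P x y| := congrArg abs (congrFun hv y)
      _ ≤ ∑ x, |v x * P x y| := Finset.abs_sum_le_sum_abs _ _
      _ = ∑ x, |v x| * P x y := by simp_rw [abs_mul, abs_of_nonneg (hS.1 _ _)]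
  -- `|v| ≤ |v| P` entrywise, and both sides have the same total mass, so they agree.
  have hmass : ∑ y, |v y| = ∑ y, ∑ x, |v x| * P x y := by
    rw [Finset.sum_comm]
    simp_rw [← Finset.mul_sum, sum_row_of_mem_rowStochastic hS, mul_one]
  have heq := (Finset.sum_eq_sum_iff_of_le hle).1 hmass
  have hpos : 0 < ∑ x, |v x| := by
    obtain ⟨x, hx⟩ := Function.ne_iff.1 hv0
    exact Finset.sum_pos' (fun _ _ => abs_nonneg _) ⟨x, Finset.mem_univ x, abs_pos.2 hx⟩
  refine ⟨fun x => |v x| / ∑ z, |v z|, ⟨fun x => by positivity, ?_⟩, ?_⟩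
  · rw [← Finset.sum_div, div_self hpos.ne']
  · ext y
    simp only [vecMul, dotProduct]
    rw [heq y (Finset.mem_univ y), Finset.sum_div]
    exact Finset.sum_congr rfl fun x _ => by ring

/-- **Poisson's equation** is solvable for every centred right-hand side. -/
theorem exists_poisson_solution (hS : P ∈ rowStochastic ℝ S) (hP : P.IsIrreducible)
    {π : S → ℝ} (hπ : IsStationaryDistribution P π) (f : S → ℝ) :
    ∃ g : S → ℝ, ∀ x, f x - π ⬝ᵥ f = g x - (P *ᵥ g) x := by
  have hπ1 : π ⬝ᵥ 1 = 1 := by simpa [dotProduct] using hπ.1.2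
  have hπP : ∀ g, π ⬝ᵥ (P *ᵥ g) = π ⬝ᵥ g := fun g => by rw [dotProduct_mulVec, hπ.2]
  let U : (S → ℝ) →ₗ[ℝ] (S → ℝ) :=
    { toFun := fun g => g - P *ᵥ g + (π ⬝ᵥ g) • 1
      map_add' := fun a b => by rw [mulVec_add, dotProduct_add, add_smul]; abel
      map_smul' := fun c a => by
        simp only [mulVec_smul, dotProduct_smul, RingHom.id_apply, smul_add, smul_sub, smul_smul,
          smul_eq_mul] }
  have hU : ∀ g, U g = g - P *ᵥ g + (π ⬝ᵥ g) • 1 := fun _ => rfl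
  have hπU : ∀ g, π ⬝ᵥ U g = π ⬝ᵥ g := fun g => by
    rw [hU, dotProduct_add, dotProduct_sub, hπP, dotProduct_smul, hπ1]; simp
  have hinj : Function.Injective U := by
    refine (injective_iff_map_eq_zero U).2 fun g hg => ?_
    have h0 : π ⬝ᵥ g = 0 := by rw [← hπU, hg, dotProduct_zero]
    have hharm : P *ᵥ g = g := by
      rw [hU, h0, zero_smul, add_zero, sub_eq_zero] at hg
      exact hg.symm
    ext x
    have hconst : g = g x • 1 := by
      ext y; simpa using eq_of_mulVec_eq_self hS hP hharm y x
    rw [hconst, dotProduct_smul, hπ1] at h0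
    simpa using h0
  obtain ⟨g, hg⟩ := (LinearMap.injective_iff_surjective.1 hinj) (f - (π ⬝ᵥ f) • 1)
  have h0 : π ⬝ᵥ g = 0 := by
    rw [← hπU, hg, dotProduct_sub, dotProduct_smul, hπ1]; simp
  refine ⟨g, fun x => ?_⟩
  have hx := congrFun hg x
  rw [hU, h0] at hx
  simpa using hx.symm

theorem existsUnique_isStationaryDistribution [Nonempty S] (hS : P ∈ rowStochastic ℝ S)
    (hP : P.IsIrreducible) : ∃! π : S → ℝ, IsStationaryDistribution P π := by
  obtain ⟨π, hπ⟩ := exists_isStationaryDistribution hS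
  refine ⟨π, hπ, fun ρ hρ => ?_⟩
  ext x
  obtain ⟨g, hg⟩ := exists_poisson_solution hS hP hπ (Pi.single x 1)
  have hρ1 : ρ ⬝ᵥ 1 = 1 := by simpa [dotProduct] using hρ.1.2
  have hfun : Pi.single x 1 - (π ⬝ᵥ Pi.single x 1) • (1 : S → ℝ) = g - P *ᵥ g := by
    ext y; simpa using hg y
  have h := congrArg (ρ ⬝ᵥ ·) hfun
  simp only [dotProduct_sub, dotProduct_smul, hρ1, dotProduct_mulVec, hρ.2, sub_self] at h
  simpa [sub_eq_zero] using h

end Stationary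

/-! ### A strong law for bounded orthogonal increments -/

/-- A sequence with bounded increments that is `o(n)` along the squares is `o(n)`. -/
theorem tendsto_div_of_tendsto_sq_div {s : ℕ → ℝ} {C : ℝ} (hs : ∀ n, |s (n + 1) - s n| ≤ C)
    (h : Tendsto (fun k : ℕ => s (k ^ 2) / (k : ℝ) ^ 2) atTop (𝓝 0)) :
    Tendsto (fun n : ℕ => s n / n) atTop (𝓝 0) := by
  have hC : 0 ≤ C := (abs_nonneg _).trans (hs 0)
  have hstep : ∀ n d, |s (n + d) - s n| ≤ C * d := by
    intro n d
    induction d with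
    | zero => simp
    | succ d ih =>
      have := abs_add_le (s (n + d + 1) - s (n + d)) (s (n + d) - s n)
      rw [sub_add_sub_cancel] at this
      have h2 := hs (n + d)
      push_cast
      rw [← add_assoc]
      linarith
  have hsqrt : Tendsto Nat.sqrt atTop atTop :=
    tendsto_atTop_atTop.2 fun b => ⟨b * b, fun a ha => Nat.le_sqrt.2 ha⟩
  have hbound : Tendsto (fun k : ℕ => |s (k ^ 2) / (k : ℝ) ^ 2| + 2 * C / (k : ℝ)) atTop (𝓝 0) := by
    simpa using h.abs.add (tendsto_const_div_atTop_nhds_zero_nat (2 * C))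
  refine squeeze_zero_norm' ?_ (hbound.comp hsqrt)
  filter_upwards [eventually_ge_atTop 1] with n hn
  simp only [Function.comp, Real.norm_eq_abs]
  set k := n.sqrt with hk
  have hk1 : 1 ≤ k := Nat.le_sqrt.2 (by simpa using hn)
  have hle : k ^ 2 ≤ n := Nat.sqrt_le' n
  have hge : n ≤ k ^ 2 + 2 * k := by
    have := Nat.sqrt_le_add n
    rw [← hk] at this
    nlinarith
  obtain ⟨d, hd⟩ := Nat.exists_eq_add_of_le hle
  have hd2 : (d : ℝ) ≤ 2 * k := by exact_mod_cast (by omega : d ≤ 2 * k)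
  have hkpos : (0 : ℝ) < k := by exact_mod_cast hk1
  have hkn : (k : ℝ) ^ 2 ≤ n := by exact_mod_cast hle
  have hmain : |s n| ≤ |s (k ^ 2)| + 2 * C * k := by
    have h1 := hstep (k ^ 2) d
    rw [← hd] at h1
    have h2 := abs_sub_abs_le_abs_sub (s n) (s (k ^ 2))
    nlinarith [mul_le_mul_of_nonneg_left hd2 hC]
  calc |s n / n| = |s n| / n := by rw [abs_div, Nat.abs_cast]
    _ ≤ |s n| / (k : ℝ) ^ 2 := by gcongr
    _ ≤ (|s (k ^ 2)| + 2 * C * k) / (k : ℝ) ^ 2 := by gcongr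
    _ = |s (k ^ 2) / (k : ℝ) ^ 2| + 2 * C / k := by
      rw [abs_div, abs_of_pos (pow_pos hkpos 2)]
      field_simp

theorem abs_sum_range_le_of_abs_le {Ω : Type*} {D : ℕ → Ω → ℝ} {C : ℝ}
    (hC : ∀ n ω, |D n ω| ≤ C) (n : ℕ) (ω : Ω) : |∑ i ∈ Finset.range n, D i ω| ≤ n * C := by
  refine (Finset.abs_sum_le_sum_abs _ _).trans ((Finset.sum_le_sum fun i _ => hC i ω).trans ?_)
  simp

section StrongLaw

variable {Ω : Type*} [MeasurableSpace Ω] {μ : Measure Ω} [IsProbabilityMeasure μ]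
  {D : ℕ → Ω → ℝ} {C : ℝ}

/-- If each increment is orthogonal to the sum of the preceding ones, variances add up. -/
theorem integral_sq_sum_le_of_orthogonal (hD : ∀ n, Measurable (D n)) (hC : ∀ n ω, |D n ω| ≤ C)
    (horth : ∀ n, ∫ ω, (∑ i ∈ Finset.range n, D i ω) * D n ω ∂μ = 0) (n : ℕ) :
    ∫ ω, (∑ i ∈ Finset.range n, D i ω) ^ 2 ∂μ ≤ n * C ^ 2 := by
  have hS : ∀ n, Measurable fun ω => ∑ i ∈ Finset.range n, D i ω := fun n =>
    Finset.measurable_sum _ fun i _ => hD i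
  have hSb := abs_sum_range_le_of_abs_le hC
  induction n with
  | zero => simp
  | succ n ih =>
    have i1 : Integrable (fun ω => (∑ i ∈ Finset.range n, D i ω) ^ 2) μ :=
      .of_bound ((hS n).pow_const 2).aestronglyMeasurable ((n * C) ^ 2) <| ae_of_all _ fun ω => by
        rw [norm_pow, Real.norm_eq_abs]; gcongr; exact hSb n ω
    have i2 : Integrable (fun ω => (∑ i ∈ Finset.range n, D i ω) * D n ω) μ :=
      .of_bound ((hS n).mul (hD n)).aestronglyMeasurable (n * C * C) <| ae_of_all _ fun ω => by
        rw [norm_mul, Real.norm_eq_abs, Real.norm_eq_abs]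
        exact mul_le_mul (hSb n ω) (hC n ω) (abs_nonneg _) ((abs_nonneg _).trans (hSb n ω))
    have hle : ∀ ω, (D n ω) ^ 2 ≤ C ^ 2 := fun ω => by
      rw [← sq_abs]; gcongr; exact hC n ω
    have i3 : Integrable (fun ω => (D n ω) ^ 2) μ :=
      .of_bound ((hD n).pow_const 2).aestronglyMeasurable (C ^ 2) <| ae_of_all _ fun ω => by
        rw [Real.norm_eq_abs, abs_of_nonneg (sq_nonneg _)]; exact hle ω
    have h3 : ∫ ω, (D n ω) ^ 2 ∂μ ≤ C ^ 2 := by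
      simpa using integral_mono i3 (integrable_const (C ^ 2)) hle
    have hexp : ∀ ω, (∑ i ∈ Finset.range (n + 1), D i ω) ^ 2 =
        (∑ i ∈ Finset.range n, D i ω) ^ 2 + 2 * ((∑ i ∈ Finset.range n, D i ω) * D n ω)
          + (D n ω) ^ 2 := fun ω => by rw [Finset.sum_range_succ]; ring
    simp_rw [hexp]
    rw [integral_add (by exact i1.add (i2.const_mul 2)) i3, integral_add i1 (i2.const_mul 2),
      integral_const_mul, horth n]
    push_cast
    linarith

theorem ae_tendsto_sum_div_of_orthogonal (hD : ∀ n, Measurable (D n)) (hC : ∀ n ω, |D n ω| ≤ C)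
    (horth : ∀ n, ∫ ω, (∑ i ∈ Finset.range n, D i ω) * D n ω ∂μ = 0) :
    ∀ᵐ ω ∂μ, Tendsto (fun n : ℕ => (∑ i ∈ Finset.range n, D i ω) / n) atTop (𝓝 0) := by
  have hS : ∀ n, Measurable fun ω => ∑ i ∈ Finset.range n, D i ω := fun n =>
    Finset.measurable_sum _ fun i _ => hD i
  set A : ℕ → Ω → ℝ := fun k ω => ((∑ i ∈ Finset.range (k ^ 2), D i ω) / (k : ℝ) ^ 2) ^ 2 with hA
  have hAm : ∀ k, Measurable (A k) := fun k => ((hS _).div_const _).pow_const 2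
  have hA0 : ∀ k ω, 0 ≤ A k ω := fun k ω => sq_nonneg _
  have hAi : ∀ k, Integrable (A k) μ := fun k =>
    .of_bound (hAm k).aestronglyMeasurable (((k ^ 2 : ℕ) * C / (k : ℝ) ^ 2) ^ 2) <|
      ae_of_all _ fun ω => by
        rw [norm_pow, Real.norm_eq_abs, abs_div, abs_of_nonneg (sq_nonneg (k : ℝ))]
        gcongr
        exact abs_sum_range_le_of_abs_le hC _ ω
  have hAint : ∀ k : ℕ, ∫ ω, A k ω ∂μ ≤ C ^ 2 * (1 / (k : ℝ) ^ 2) := fun k => by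
    rcases Nat.eq_zero_or_pos k with rfl | hk
    · simp [hA]
    have hk' : (0 : ℝ) < k := by exact_mod_cast hk
    simp only [hA, div_pow, integral_div]
    calc _ ≤ ((k ^ 2 : ℕ) * C ^ 2) / ((k : ℝ) ^ 2) ^ 2 := by
          gcongr
          exact integral_sq_sum_le_of_orthogonal hD hC horth _
      _ = C ^ 2 * (1 / (k : ℝ) ^ 2) := by
          push_cast
          field_simp
  have hfin : ∫⁻ ω, ∑' k, ENNReal.ofReal (A k ω) ∂μ ≠ ⊤ := by
    rw [lintegral_tsum fun k => (hAm k).ennreal_ofReal.aemeasurable]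
    have hsum : Summable fun k : ℕ => C ^ 2 * (1 / (k : ℝ) ^ 2) :=
      (Real.summable_one_div_nat_pow.2 one_lt_two).mul_left _
    refine ne_top_of_le_ne_top hsum.tsum_ofReal_ne_top (ENNReal.tsum_le_tsum fun k => ?_)
    rw [← ofReal_integral_eq_lintegral_ofReal (hAi k) (ae_of_all _ (hA0 k))]
    exact ENNReal.ofReal_le_ofReal (hAint k)
  filter_upwards [ae_lt_top (Measurable.tsum fun k => (hAm k).ennreal_ofReal) hfin]
    with ω hω
  refine tendsto_div_of_tendsto_sq_div (C := C) (fun n => ?_) ?_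
  · rw [Finset.sum_range_succ, add_sub_cancel_left]
    exact hC n ω
  have h0 := (ENNReal.tendsto_toReal ENNReal.zero_ne_top).comp
    (ENNReal.tendsto_atTop_zero_of_tsum_ne_top hω.ne)
  simp only [Function.comp_def, ENNReal.toReal_ofReal (hA0 _ ω), ENNReal.toReal_zero] at h0
  have h1 := h0.sqrt
  simp only [hA, Real.sqrt_sq_eq_abs, Real.sqrt_zero] at h1
  exact (tendsto_zero_iff_abs_tendsto_zero _).2 h1

end StrongLaw

/-! ### The Markov property against functions of the past -/

namespace IsMarkovChain

variable {Ω S : Type*} [MeasurableSpace Ω] [Fintype S] [DecidableEq S] [MeasurableSpace S]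
  [MeasurableSingletonClass S] {μ : Measure Ω} {P : Matrix S S ℝ} {X : ℕ → Ω → S}

theorem measureReal_history_inter [IsProbabilityMeasure μ] (hX : IsMarkovChain μ P X) (n : ℕ)
    (j : Fin (n + 1) → S) (y : S) :
    μ.real {ω | (∀ k : Fin (n + 1), X k ω = j k) ∧ X (n + 1) ω = y} =
      μ.real {ω | ∀ k : Fin (n + 1), X k ω = j k} * P (j (Fin.last n)) y := by
  -- `markov` takes histories indexed by all of `ℕ`; the values beyond `n` are irrelevant.
  let j' : ℕ → S := fun k => j (Fin.ofNat (n + 1) k)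
  have hj : ∀ k : Fin (n + 1), j' k = j k := fun k => by simp [j']
  have hset : {ω | ∀ k : Fin (n + 1), X k ω = j k} = {ω | ∀ k ≤ n, X k ω = j' k} := by
    ext ω
    simp only [Set.mem_ofPred_eq]
    refine ⟨fun h k hk => ?_, fun h k => (h k (Nat.lt_succ_iff.1 k.2)).trans (hj k)⟩
    exact (h ⟨k, Nat.lt_succ_iff.2 hk⟩).trans (hj ⟨k, Nat.lt_succ_iff.2 hk⟩).symm
  have hinter : {ω | (∀ k : Fin (n + 1), X k ω = j k) ∧ X (n + 1) ω = y} =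
      {ω | ∀ k ≤ n, X k ω = j' k} ∩ {ω | X (n + 1) ω = y} := by
    rw [← hset]; rfl
  have hmeas : MeasurableSet {ω | ∀ k ≤ n, X k ω = j' k} := by
    rw [← hset, Set.ofPred_forall]
    exact MeasurableSet.iInter fun k => hX.measurable k (measurableSet_singleton _)
  rw [hinter, hset]
  by_cases h0 : μ {ω | ∀ k ≤ n, X k ω = j' k} = 0
  · rw [measureReal_def, measureReal_def, measure_inter_null_of_null_left _ h0, h0]
    simp
  obtain ⟨h1, h2⟩ := hX.markov n j' y h0
  have hlast : j' n = j (Fin.last n) := by simpa using hj (Fin.last n)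
  rw [measureReal_def, ← cond_mul_eq_inter hmeas, h1, h2, hlast, ENNReal.toReal_mul,
    ENNReal.toReal_ofReal (hX.stochastic.1 _ _), mul_comm, measureReal_def]

/-- The increments `g (X_{n+1}) - (P g) (X_n)` are orthogonal to every function of the past. -/
theorem integral_history_mul_eq_zero [IsProbabilityMeasure μ] (hX : IsMarkovChain μ P X)
    (g : S → ℝ) (n : ℕ) (h : (Fin (n + 1) → S) → ℝ) :
    ∫ ω, h (fun k => X k ω) * (g (X (n + 1) ω) - (P.mulVec g) (X n ω)) ∂μ = 0 := by
  let Z : Ω → (Fin (n + 1) → S) × S := fun ω => (fun k => X k ω, X (n + 1) ω)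
  have hZ : Measurable Z :=
    (measurable_pi_lambda _ fun k : Fin (n + 1) => hX.measurable k).prodMk (hX.measurable (n + 1))
  let F : (Fin (n + 1) → S) × S → ℝ := fun p => h p.1 * (g p.2 - (P.mulVec g) (p.1 (Fin.last n)))
  have hFZ : ∀ ω, h (fun k => X k ω) * (g (X (n + 1) ω) - (P.mulVec g) (X n ω)) = F (Z ω) :=
    fun ω => by simp [F, Z]
  simp_rw [hFZ]
  have := Measure.isProbabilityMeasure_map (μ := μ) hZ.aemeasurable
  rw [← integral_map hZ.aemeasurable (measurable_of_finite F).aestronglyMeasurable,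
    integral_fintype .of_finite, Fintype.sum_prod_type]
  refine Finset.sum_eq_zero fun j _ => ?_
  have hmass : ∀ y, (μ.map Z).real {(j, y)} =
      μ.real {ω | ∀ k : Fin (n + 1), X k ω = j k} * P (j (Fin.last n)) y := fun y => by
    rw [map_measureReal_apply hZ (measurableSet_singleton _), ← hX.measureReal_history_inter]
    congr 1
    ext ω
    simp [Z, funext_iff]
  have hsum : ∑ y, P (j (Fin.last n)) y * (g y - (P.mulVec g) (j (Fin.last n))) = 0 := by
    simp_rw [mul_sub, Finset.sum_sub_distrib, ← Finset.sum_mul,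
      Matrix.sum_row_of_mem_rowStochastic hX.stochastic]
    simp [Matrix.mulVec, dotProduct]
  calc _ = ∑ y, μ.real {ω | ∀ k : Fin (n + 1), X k ω = j k} * h j *
        (P (j (Fin.last n)) y * (g y - (P.mulVec g) (j (Fin.last n)))) :=
        Finset.sum_congr rfl fun y _ => by rw [hmass, smul_eq_mul]; ring
    _ = 0 := by rw [← Finset.mul_sum, hsum, mul_zero]

/-- The ergodic theorem for functions of the form `g - P g`. -/
theorem ae_tendsto_average_sub_mulVec [IsProbabilityMeasure μ] (hX : IsMarkovChain μ P X)
    (g : S → ℝ) :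
    ∀ᵐ ω ∂μ, Tendsto
      (fun n : ℕ => (∑ j ∈ Finset.range n, (g (X j ω) - (P.mulVec g) (X j ω))) / (n : ℝ))
      atTop (𝓝 0) := by
  let D : ℕ → Ω → ℝ := fun n ω => g (X (n + 1) ω) - (P.mulVec g) (X n ω)
  obtain ⟨B, hB⟩ : ∃ B, ∀ x, |g x| ≤ B :=
    ⟨∑ x, |g x|, fun x => Finset.single_le_sum (f := fun x => |g x|)
      (fun _ _ => abs_nonneg _) (Finset.mem_univ x)⟩
  obtain ⟨B', hB'⟩ : ∃ B, ∀ x, |(P.mulVec g) x| ≤ B :=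
    ⟨∑ x, |(P.mulVec g) x|, fun x => Finset.single_le_sum (f := fun x => |(P.mulVec g) x|)
      (fun _ _ => abs_nonneg _) (Finset.mem_univ x)⟩
  have hDm : ∀ n, Measurable (D n) := fun n =>
    ((measurable_of_finite g).comp (hX.measurable (n + 1))).sub
      ((measurable_of_finite (P.mulVec g)).comp (hX.measurable n))
  have hDC : ∀ n ω, |D n ω| ≤ B + B' := fun n ω =>
    (abs_sub _ _).trans (add_le_add (hB _) (hB' _))
  have horth : ∀ n, ∫ ω, (∑ i ∈ Finset.range n, D i ω) * D n ω ∂μ = 0 := fun n => by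
    have h := hX.integral_history_mul_eq_zero g n
      fun j => ∑ i : Fin n, (g (j i.succ) - (P.mulVec g) (j i.castSucc))
    simpa [Finset.sum_range, D] using h
  filter_upwards [ae_tendsto_sum_div_of_orthogonal hDm hDC horth] with ω hω
  have hbdry : Tendsto (fun n : ℕ => (g (X 0 ω) - g (X n ω)) / (n : ℝ)) atTop (𝓝 0) := by
    refine squeeze_zero_norm (fun n => ?_) (tendsto_const_div_atTop_nhds_zero_nat (B + B))
    rw [norm_div, Real.norm_natCast]
    gcongr
    exact (abs_sub _ _).trans (add_le_add (hB _) (hB _))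
  have hadd := hbdry.add hω
  rw [add_zero] at hadd
  refine hadd.congr fun n => ?_
  rw [← add_div, ← Finset.sum_range_sub' (fun k => g (X k ω)), ← Finset.sum_add_distrib]
  congr 1
  exact Finset.sum_congr rfl fun k _ => by simp only [D]; ring

end IsMarkovChain

theorem mainTheorem2 {Ω S : Type*} [MeasurableSpace Ω] [Fintype S] [DecidableEq S]
    [MeasurableSpace S] [MeasurableSingletonClass S]
    (μ : Measure Ω) [IsProbabilityMeasure μ]
    (P : Matrix S S ℝ) (X : ℕ → Ω → S)
    (hX : IsMarkovChain μ P X) (hP : P.IsIrreducible) :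
    (∃! π : S → ℝ, IsStationaryDistribution P π) ∧
      ∀ π : S → ℝ, IsStationaryDistribution P π →
        ∀ f : S → ℝ, ∀ᵐ ω ∂μ,
          Tendsto (fun n : ℕ => (1 / (n : ℝ)) * ∑ j ∈ Finset.range n, f (X j ω)) atTop
            (𝓝 (∑ x, π x * f x)) := by
  have : Nonempty S := (nonempty_of_isProbabilityMeasure μ).map (X 0)
  refine ⟨existsUnique_isStationaryDistribution hX.stochastic hP, fun π hπ f => ?_⟩
  obtain ⟨g, hg⟩ := exists_poisson_solution hX.stochastic hP hπ f
  filter_upwards [hX.ae_tendsto_average_sub_mulVec g] with ω hω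
  have h := hω.add_const (∑ x, π x * f x)
  rw [zero_add] at h
  refine h.congr' ?_
  -- Division by `n` only cancels for `n ≠ 0`.
  filter_upwards [eventually_ne_atTop 0] with n hn
  have hn' : (n : ℝ) ≠ 0 := Nat.cast_ne_zero.2 hn
  simp_rw [← hg, Finset.sum_sub_distrib, Finset.sum_const, Finset.card_range, nsmul_eq_mul,
    dotProduct]
  field_simp
  ring
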